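/- A finite graph means a Hausdorff space that admits the structure of a finite CW complex of dimension at most $1$ (loops and multiple edges are allowed); a tree means a space homeomorphic to the geometric realization of a finite connected acyclic graph. For a group $H$ acting on a space $X$ and a space $Y$, a free homotopy class $\alpha\in[X,Y]$ has the Borsuk--Ulam property if for every continuous map $f\colon X\to Y$ representing $\alpha$ there are $x\in X$ and $h_1\neq h_2$ in $H$ with $f(h_1\cdot x)=f(h_2\cdot x)$. Let $n\ge 2$ and let $\Gamma$ be a connected finite graph with a free continuous action of $\mathbb{Z}_n=\mathbb{Z}/n\mathbb{Z}$. Then: (a) If $G$ is the unit interval $I=[0,1]$, or any space homeomorphic to $I$, then every free homotopy class in $[\Gamma,G]$ has the Borsuk--Ulam property; that is, every continuous map $\Gamma\to G$ fails to be injective on some $\mathbb{Z}_n$-orbit. (b) If $G$ is a tree that has more than one point and is not homeomorphic to $I$, then $[\Gamma,G]$ consists of exactly one free homotopy class, and this class does not have the Borsuk--Ulam property; that is, there is a continuous map $\Gamma\to G$ that is injective on every $\mathbb{Z}_n$-orbit. -/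

import Mathlib

/-- The set `[X, Y]` of free homotopy classes of continuous maps `X → Y`. -/
abbrev FreeHomotopyClass (X Y : Type*) [TopologicalSpace X] [TopologicalSpace Y] :=
  Quotient (⟨ContinuousMap.Homotopic, ContinuousMap.Homotopic.equivalence⟩ : Setoid C(X, Y))

/-- The free homotopy class of a continuous map. -/
def freeHomotopyClassOf {X Y : Type*} [TopologicalSpace X] [TopologicalSpace Y] (f : C(X, Y)) :
    FreeHomotopyClass X Y :=
  Quotient.mk _ f

/-- A free homotopy class `α ∈ [X, Y]` has the Borsuk–Ulam property with respect to an action of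
`H` on `X` if every representative of `α` identifies `h₁ • x` and `h₂ • x` for some `x : X` and
some `h₁ ≠ h₂` in `H`. -/
def FreeHomotopyClass.HasBorsukUlam (H : Type*) {X Y : Type*} [Group H] [TopologicalSpace X]
    [TopologicalSpace Y] [MulAction H X] (α : FreeHomotopyClass X Y) : Prop :=
  ∀ f : C(X, Y), freeHomotopyClassOf f = α →
    ∃ (h₁ h₂ : H) (x : X), h₁ ≠ h₂ ∧ f (h₁ • x) = f (h₂ • x)

/-- The triple `(X, τ, Y)`, where `τ` is the given action of `H` on `X`, satisfies the Borsuk–Ulam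
property if every free homotopy class in `[X, Y]` has it. -/
def TripleHasBorsukUlam (H X Y : Type*) [Group H] [TopologicalSpace X]
    [TopologicalSpace Y] [MulAction H X] : Prop :=
  ∀ α : FreeHomotopyClass X Y, α.HasBorsukUlam H

/-- A finite (topological) graph: a Hausdorff space that carries the structure of a finite CW
complex with cells of dimensions `0` and `1` only. Loops and multiple edges are allowed. -/
def IsFiniteGraph (X : Type*) [TopologicalSpace X] : Prop :=
  T2Space X ∧ ∃ _ : Topology.CWComplex (Set.univ : Set X),
    Topology.CWComplex.Finite (Set.univ : Set X) ∧
    ∀ k : ℕ, 2 ≤ k → IsEmpty (Topology.CWComplex.cell (Set.univ : Set X) k)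

/-- The geometric realization of a simple graph on `m` vertices: the vertices are the
standard basis vectors of `ℝ^m`, and adjacent vertices are joined by the straight segment between
them. It carries the subspace topology of `ℝ^m`. -/
def SimpleGraph.geomRealization {m : ℕ} (T : SimpleGraph (Fin m)) : Set (Fin m → ℝ) :=
  {p | ∃ v, p = Pi.single v 1} ∪
    {p | ∃ u v, T.Adj u v ∧ p ∈ segment ℝ (Pi.single u (1 : ℝ)) (Pi.single v (1 : ℝ))}

/-- A (finite, topological) tree: a space homeomorphic to the geometric realization of a finite
connected acyclic graph. -/
def IsTopologicalTree (X : Type*) [TopologicalSpace X] : Prop :=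
  ∃ (m : ℕ) (T : SimpleGraph (Fin m)), T.IsTree ∧ Nonempty (X ≃ₜ T.geomRealization)

/-! For the interval, pick `g ≠ 1` and compare `f (g • x)` with `f x` where `f` is largest and
smallest along the finite orbit of a point under powers of `g`. The difference changes sign, so it
vanishes somewhere on the connected space (`IsPreconnected.exists_eq_smul`).

A nontrivial tree without branching is an interval, so any other nontrivial tree contains a tripod.
There `n` points can be permuted cyclically without collisions, by parking one on the third leg
while the others slide past (`exists_joinedIn_injective_shift`). A map injective on orbits amounts
to an equivariant map into injective configurations, and these paths build one. Near the orbits of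
the vertices, use an equivariant locally constant label `i`. On the rest of the graph, use another
one, `j`. The second exists because the group permutes freely the components left by removing those
orbits: each lies in an open edge, and an element preserving it would fix a point by the interval
argument. The paths of configurations interpolate between `a ∘ i` and `a ∘ j`
(`exists_continuousMap_injective_on_orbits`).

Collapsing a tree level by level onto its root shows that it is contractible, so there is only one
homotopy class. -/

/-! ### Finite graphs as one-manifolds off their vertices -/

open Set Topology in
/-- A finite graph is compact, and away from a finite set of vertices it is covered by charts onto
open subsets of the line whose sources are relatively closed in the complement of the vertices. -/
lemma IsFiniteGraph.exists_finite_charts {X : Type*} [TopologicalSpace X] (hX : IsFiniteGraph X) :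
    CompactSpace X ∧ ∃ V : Set X, V.Finite ∧ ∀ x ∉ V,
      ∃ e : OpenPartialHomeomorph X (Fin 1 → ℝ),
        x ∈ e.source ∧ Disjoint e.source V ∧ IsClosed (e.source ∪ V) := by
  obtain ⟨hT2, hCW, hfin, hdim⟩ := hX
  have hcells : Finite (Σ n, RelCWComplex.cell (univ : Set X) n) :=
    RelCWComplex.finite_cells_of_finite (finite := hfin)
  have hfinite (k : ℕ) : Finite (RelCWComplex.cell (univ : Set X) k) :=
    Finite.of_injective (fun i ↦ (⟨k, i⟩ : Σ n, RelCWComplex.cell (univ : Set X) n))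
      fun i j h ↦ by simpa using h
  set V : Set X := ⋃ j : RelCWComplex.cell (univ : Set X) 0, RelCWComplex.closedCell 0 j with hV
  have hVfin : V.Finite := finite_iUnion fun j ↦ by
    rw [RelCWComplex.closedCell_zero_eq_singleton]; exact finite_singleton _
  have hfrontier (i : RelCWComplex.cell (univ : Set X) 1) : RelCWComplex.cellFrontier 1 i ⊆ V := by
    obtain ⟨x, y, h⟩ := CWComplex.exists_cellFrontier_one_eq i
    rw [h]
    exact union_subset (subset_iUnion_of_subset x subset_rfl) (subset_iUnion_of_subset y subset_rfl)
  have hclosed_union (i : RelCWComplex.cell (univ : Set X) 1) :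
      RelCWComplex.openCell 1 i ∪ V = RelCWComplex.closedCell 1 i ∪ V := by
    rw [← RelCWComplex.cellFrontier_union_openCell_eq_closedCell]
    have := hfrontier i
    grind
  have hdisj (i : RelCWComplex.cell (univ : Set X) 1) :
      Disjoint (RelCWComplex.openCell 1 i) V := by
    rw [hV, disjoint_iUnion_right]
    intro j
    rw [RelCWComplex.closedCell_zero_eq_singleton, ← RelCWComplex.openCell_zero_eq_singleton]
    exact RelCWComplex.disjoint_openCell_of_ne (by simp)
  have hcover (x : X) : x ∈ V ∨ ∃ i : RelCWComplex.cell (univ : Set X) 1,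
      x ∈ RelCWComplex.openCell 1 i := by
    have hx : x ∈ (univ : Set X) := mem_univ x
    rw [← CWComplex.iUnion_openCell_eq_complex (C := (univ : Set X))] at hx
    simp only [mem_iUnion] at hx
    obtain ⟨k, j, hj⟩ := hx
    match k, j, hj with
    | 0, j, hj => exact .inl (mem_iUnion.2 ⟨j, RelCWComplex.openCell_subset_closedCell _ _ hj⟩)
    | 1, j, hj => exact .inr ⟨j, hj⟩
    | k + 2, j, _ => exact ((hdim (k + 2) (by lia)).false j).elim
  have hopen (i : RelCWComplex.cell (univ : Set X) 1) :
      IsOpen (RelCWComplex.openCell 1 i) := by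
    -- An open edge is open in the graph because its complement is a finite union of closed cells.
    have h : (RelCWComplex.openCell 1 i)ᶜ =
        V ∪ ⋃ j : {j // j ≠ i}, RelCWComplex.closedCell 1 j.1 := by
      ext x
      simp only [mem_compl_iff, mem_union, mem_iUnion]
      constructor
      · intro hx
        rcases hcover x with h | ⟨j, hj⟩
        · exact .inl h
        · refine .inr ⟨⟨j, ?_⟩, RelCWComplex.openCell_subset_closedCell _ _ hj⟩
          rintro rfl
          exact hx hj
      · rintro (h | ⟨⟨j, hj⟩, hx⟩) hxi
        · exact (hdisj i).le_bot ⟨hxi, h⟩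
        · rw [← RelCWComplex.cellFrontier_union_openCell_eq_closedCell] at hx
          rcases hx with hx | hx
          · exact (hdisj i).le_bot ⟨hxi, hfrontier j hx⟩
          · have : Disjoint (RelCWComplex.openCell 1 j) (RelCWComplex.openCell 1 i) :=
              RelCWComplex.disjoint_openCell_of_ne (by simpa using hj)
            exact this.le_bot ⟨hx, hxi⟩
    rw [← isClosed_compl_iff, h]
    exact hVfin.isClosed.union (isClosed_iUnion_of_finite fun j ↦ RelCWComplex.isClosed_closedCell)
  refine ⟨⟨?_⟩, V, hVfin, fun x hx ↦ ?_⟩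
  · have h : (univ : Set X) = V ∪ ⋃ i : RelCWComplex.cell (univ : Set X) 1,
        RelCWComplex.closedCell 1 i := by
      refine (eq_univ_of_forall fun x ↦ ?_).symm
      rcases hcover x with h | ⟨i, hi⟩
      · exact .inl h
      · exact .inr (mem_iUnion.2 ⟨i, RelCWComplex.openCell_subset_closedCell _ _ hi⟩)
    rw [h]
    exact hVfin.isCompact.union (isCompact_iUnion fun i ↦ RelCWComplex.isCompact_closedCell)
  · obtain ⟨i, hi⟩ := (hcover x).resolve_left hx
    have htarget : (RelCWComplex.map 1 i).target = RelCWComplex.openCell 1 i := by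
      rw [← PartialEquiv.image_source_eq_target, RelCWComplex.source_eq]
      rfl
    refine ⟨{ toPartialEquiv := (RelCWComplex.map 1 i).symm
              open_source := ?_
              open_target := ?_
              continuousOn_toFun := RelCWComplex.continuousOn_symm 1 i
              continuousOn_invFun := ?_ }, ?_, ?_, ?_⟩
    · simpa [RelCWComplex.source_eq] using
        (RelCWComplex.continuousOn 1 i).mono Metric.ball_subset_closedBall
    · simpa [htarget] using hopen i
    · simp [RelCWComplex.source_eq, Metric.isOpen_ball]
    · simpa [htarget] using hi
    · simpa [htarget] using hdisj i
    · simpa [htarget, hclosed_union] using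
        RelCWComplex.isClosed_closedCell.union hVfin.isClosed

/-! ### Intermediate values along orbits, and equivariant labels -/

open Set Topology in
/-- A continuous real function on a nonempty connected set preserved by an element of a finite
group takes the same value at some point and its translate. -/
lemma IsPreconnected.exists_eq_smul {H X : Type*} [Group H] [Finite H] [TopologicalSpace X]
    [MulAction H X] [ContinuousConstSMul H X] {S : Set X} (hS : IsPreconnected S)
    (hne : S.Nonempty) {g : H} (hg : ∀ x ∈ S, g • x ∈ S) {f : X → ℝ} (hf : ContinuousOn f S) :
    ∃ x ∈ S, f (g • x) = f x := by
  obtain ⟨x, hx⟩ := hne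
  have hpow (z : Submonoid.powers g) : (z : H) • x ∈ S := by
    obtain ⟨_, k, rfl⟩ := z
    induction k with
    | zero => simpa using hx
    | succ k ih => simpa [pow_succ', mul_smul] using hg _ ih
  have hstep (z : Submonoid.powers g) : ∃ w : Submonoid.powers g, (w : H) • x = g • (z : H) • x :=
    ⟨⟨g, Submonoid.mem_powers g⟩ * z, by simp [mul_smul]⟩
  obtain ⟨a, ha⟩ := Finite.exists_min fun z : Submonoid.powers g ↦ f ((z : H) • x)
  obtain ⟨b, hb⟩ := Finite.exists_max fun z : Submonoid.powers g ↦ f ((z : H) • x)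
  obtain ⟨a_next, ha_next⟩ := hstep a
  obtain ⟨b_next, hb_next⟩ := hstep b
  -- Translation by `g` cannot increase `f` at the orbit maximum `b`, nor decrease it at the minimum
  -- `a`.
  refine hS.intermediate_value₂ (hpow b) (hpow a)
    (hf.comp (continuous_const_smul g).continuousOn hg) hf ?_ ?_
  · simpa [← hb_next] using hb b_next
  · simpa [← ha_next] using ha a_next

/-- For an action of a group `H` there is a map to `H` which is equivariant at all points with
trivial stabilizer. -/
lemma MulAction.exists_map_smul_eq_mul (H α : Type*) [Group H] [MulAction H α] :
    ∃ σ : α → H, ∀ a, (∀ h : H, h • a = a → h = 1) → ∀ h : H, σ (h • a) = h * σ a := by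
  let out (a : α) : α := (Quotient.mk (MulAction.orbitRel H α) a).out
  have hout (a : α) : ∃ h : H, h • out a = a := by
    have h : (MulAction.orbitRel H α) (out a) a := Quotient.mk_out a
    exact MulAction.mem_orbit_symm.1 h
  choose σ hσ using hout
  refine ⟨σ, fun a ha h ↦ ?_⟩
  have hsame : out (h • a) = out a :=
    congrArg Quotient.out (Quotient.sound (MulAction.mem_orbit a h))
  have h1 : σ (h • a) • out a = h • a := by rw [← hsame, hσ]
  have h2 : out a = (σ a)⁻¹ • a := eq_inv_smul_iff.2 (hσ a)
  -- Both `σ (h • a)` and `h * σ a` carry the orbit representative to `h • a`, so they differ by a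
  -- stabilizer element.
  have h3 : (h⁻¹ * (σ (h • a) * (σ a)⁻¹)) • a = a := by
    rw [mul_smul, mul_smul, ← h2, h1, inv_smul_smul]
  have h4 := ha _ h3
  rw [inv_mul_eq_one, eq_mul_inv_iff_mul_eq] at h4
  exact h4.symm

/-! ### Cyclic motion of points on a tripod -/

/-- The configurations `a` and `a ∘ (· + d)` of `n` points on a tripod are connected by a path of
configurations. The tripod consists of a line `L` and a leg `S` attached to it at `0`. -/
lemma exists_joinedIn_injective_shift {Y : Type*} [TopologicalSpace Y] {n : ℕ} [NeZero n]
    {L S : ℝ → Y} (hL : Continuous L) (hS : Continuous S) (h0 : S 0 = L 0)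
    (hLinj : Set.InjOn L (Set.Icc (-(n + 1)) (n + 1)))
    (hLS : ∀ s ∈ Set.Icc (-(n + 1) : ℝ) (n + 1), ∀ t ∈ Set.Ioc (0 : ℝ) 1, S t ≠ L s) :
    ∃ a : ZMod n → Y, ∀ d : ZMod n,
      JoinedIn {c : ZMod n → Y | Function.Injective c} a (fun k ↦ a (k + d)) := by
  classical
  set F : Set (ZMod n → Y) := {c | Function.Injective c}
  -- Point `0` moves freely while the others form a rigid train on the line. For `s ∈ [-n, 1]` the
  -- train stays within `[1 - n, n]`, where `L` is injective.
  let p (x : Y) (s : ℝ) (k : ZMod n) : Y := if k = 0 then x else L (k.val + s)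
  have hval (k : ZMod n) : (k.val : ℝ) + 1 ≤ n := by exact_mod_cast ZMod.val_lt k
  have hval1 {k : ZMod n} (hk : k ≠ 0) : (1 : ℝ) ≤ k.val := by
    exact_mod_cast Nat.one_le_iff_ne_zero.2 (by simpa using hk)
  have hpF {x : Y} {s : ℝ} (hs : s ∈ Set.Icc (-n : ℝ) 1)
      (hx : ∀ k : ZMod n, k ≠ 0 → x ≠ L (k.val + s)) : p x s ∈ F := by
    intro k l hkl
    by_cases hk : k = 0 <;> by_cases hl : l = 0
    · rw [hk, hl]
    · simp only [p, hk, hl, if_true, if_false] at hkl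
      exact (hx l hl hkl).elim
    · simp only [p, hk, hl, if_true, if_false] at hkl
      exact (hx k hk hkl.symm).elim
    · simp only [p, hk, hl, if_false] at hkl
      have := hLinj ⟨by linarith [hs.1, hval1 hk], by linarith [hs.2, hval k]⟩
        ⟨by linarith [hs.1, hval1 hl], by linarith [hs.2, hval l]⟩ hkl
      exact ZMod.val_injective n (by exact_mod_cast (add_right_cancel this : (k.val : ℝ) = l.val))
  have move {x : ℝ → Y} {s : ℝ → ℝ} (hx : Continuous x) (hs : Continuous s)
      (hmem : ∀ t ∈ Set.Icc (0 : ℝ) 1, s t ∈ Set.Icc (-n : ℝ) 1)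
      (hne : ∀ t ∈ Set.Icc (0 : ℝ) 1, ∀ k : ZMod n, k ≠ 0 → x t ≠ L (k.val + s t)) :
      JoinedIn F (p (x 0) (s 0)) (p (x 1) (s 1)) := by
    refine JoinedIn.ofLine (f := fun t ↦ p (x t) (s t)) ?_ rfl rfl ?_
    · refine Continuous.continuousOn (continuous_pi fun k ↦ ?_)
      by_cases hk : k = 0
      · simpa [p, hk] using hx
      · simp only [p, hk, if_false]
        fun_prop
    · rintro _ ⟨t, ht, rfl⟩
      exact hpF (hmem t ht) (hne t ht)
  have hn0 : (1 : ℝ) ≤ n := by exact_mod_cast Nat.one_le_iff_ne_zero.2 (NeZero.ne n)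
  have hne_line {u s : ℝ} (hu : u ∈ Set.Icc (-(n + 1) : ℝ) (n + 1)) (hs : s ∈ Set.Icc (-n : ℝ) 1)
      {k : ZMod n} (hk : k ≠ 0) (huk : u ≠ k.val + s) : L u ≠ L (k.val + s) := fun h ↦
    huk (hLinj hu ⟨by linarith [hs.1, hval1 hk], by linarith [hs.2, hval k]⟩ h)
  have hne_leg {t s : ℝ} (ht : t ∈ Set.Icc (0 : ℝ) 1) (hs : s ∈ Set.Icc (-n : ℝ) 1)
      {k : ZMod n} (hk : k ≠ 0) (h0k : (0 : ℝ) ≠ k.val + s ∨ 0 < t) : S t ≠ L (k.val + s) := by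
    rcases ht.1.eq_or_lt with rfl | hpos
    · rw [h0]
      exact hne_line ⟨by linarith, by linarith⟩ hs hk (h0k.resolve_right (lt_irrefl _))
    · exact hLS _ ⟨by linarith [hs.1, hval1 hk], by linarith [hs.2, hval k]⟩ t ⟨hpos, ht.2⟩
  -- With the train at `2, …, n`, point `0` goes from `1` to the junction and up the leg. The train
  -- slides to `1 - n, …, -1`, point `0` comes down and runs to `n`, and the train returns to `1, …,
  -- n - 1`. Every point thus takes its predecessor's place, cyclically.
  have enter : JoinedIn F (p (L 1) 1) (p (L 0) 1) := by
    have := move (x := fun t ↦ L (1 - t)) (s := fun _ ↦ 1) (by fun_prop) continuous_const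
      (fun t _ ↦ ⟨by linarith, le_rfl⟩) fun t ht k hk ↦ hne_line
        ⟨by linarith [ht.2], by linarith [ht.1]⟩ ⟨by linarith, le_rfl⟩ hk
        (by have := hval1 hk; have := ht.1; intro h; linarith)
    simpa using this
  have park : JoinedIn F (p (L 0) 1) (p (S 1) 1) := by
    have := move (x := S) (s := fun _ ↦ 1) hS continuous_const
      (fun t _ ↦ ⟨by linarith, le_rfl⟩) fun t ht k hk ↦ hne_leg ht ⟨by linarith, le_rfl⟩ hk
        (.inl (by have := hval1 hk; intro h; linarith))
    simpa [h0] using this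
  have slide : JoinedIn F (p (S 1) 1) (p (S 1) (-n)) := by
    have := move (x := fun _ ↦ S 1) (s := fun t ↦ 1 - t * (n + 1)) continuous_const (by fun_prop)
      (fun t ht ↦ ⟨by nlinarith [ht.2], by nlinarith [ht.1]⟩) fun t ht k hk ↦
        hne_leg ⟨zero_le_one, le_rfl⟩ ⟨by nlinarith [ht.2], by nlinarith [ht.1]⟩ hk
          (.inr zero_lt_one)
    simpa using this
  have unpark : JoinedIn F (p (S 1) (-n)) (p (L 0) (-n)) := by
    have := move (x := S) (s := fun _ ↦ (-n : ℝ)) hS continuous_const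
      (fun t _ ↦ ⟨le_rfl, by linarith⟩) fun t ht k hk ↦ hne_leg ht ⟨le_rfl, by linarith⟩ hk
        (.inl (by have := hval k; intro h; linarith))
    simpa [h0] using this.symm
  have leave : JoinedIn F (p (L 0) (-n)) (p (L n) (-n)) := by
    have := move (x := fun t ↦ L (t * n)) (s := fun _ ↦ (-n : ℝ)) (by fun_prop) continuous_const
      (fun t _ ↦ ⟨le_rfl, by linarith⟩) fun t ht k hk ↦ hne_line
        ⟨by nlinarith [ht.1], by nlinarith [ht.2]⟩ ⟨le_rfl, by linarith⟩ hk
        (by have := hval k; have : 0 ≤ t * n := mul_nonneg ht.1 (by linarith); intro h; linarith)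
    simpa using this
  have back : JoinedIn F (p (L n) (-n)) (p (L n) 0) := by
    have := move (x := fun _ ↦ L n) (s := fun t ↦ -n + t * n) continuous_const (by fun_prop)
      (fun t ht ↦ ⟨by nlinarith [ht.1], by nlinarith [ht.2]⟩) fun t ht k hk ↦
        hne_line ⟨by linarith, by linarith⟩ ⟨by nlinarith [ht.1], by nlinarith [ht.2]⟩ hk
          (by have := hval k; have : t * n ≤ 1 * n := by gcongr; exact ht.2
              intro h; linarith)
    simpa using this
  let a (k : ZMod n) : Y := L (k.val + 1)
  have ha : p (L 1) 1 = a := by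
    ext k
    by_cases hk : k = 0 <;> simp [p, a, hk]
  have ha' : p (L n) 0 = fun k ↦ a (k - 1) := by
    ext k
    by_cases hk : k = 0
    · subst hk
      simp only [p, a, if_true, zero_sub]
      obtain ⟨m, rfl⟩ : ∃ m, n = m + 1 := Nat.exists_eq_succ_of_ne_zero (NeZero.ne n)
      simp [ZMod.val_neg_one]
    · simp only [p, a, hk, if_false, add_zero]
      congr 1
      have h1 : k - 1 = ((k.val - 1 : ℕ) : ZMod n) := by
        rw [Nat.cast_sub (by exact_mod_cast hval1 hk)]
        simp
      rw [h1, ZMod.val_natCast_of_lt (by have := ZMod.val_lt k; lia),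
        Nat.cast_sub (by exact_mod_cast hval1 hk)]
      simp
  have shift : JoinedIn F a (fun k ↦ a (k - 1)) :=
    ha' ▸ ha ▸ ((((enter.trans park).trans slide).trans unpark).trans leave).trans back
  have shifts (m : ℕ) : JoinedIn F a (fun k ↦ a (k - m)) := by
    induction m with
    | zero => simpa using JoinedIn.refl shift.source_mem
    | succ m ih =>
      refine shift.trans ?_
      -- Reindexing a path of injective configurations gives another, so single shifts can be
      -- concatenated.
      have h := ih.map (f := fun c k ↦ c (k - 1)) (by fun_prop)
      have hsub : (fun c : ZMod n → Y ↦ fun k ↦ c (k - 1)) '' F ⊆ F := by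
        rintro _ ⟨c, hc, rfl⟩
        exact hc.comp (sub_left_injective (b := (1 : ZMod n)))
      simpa [sub_sub, add_comm] using h.mono hsub
  refine ⟨a, fun d ↦ ?_⟩
  have := shifts (-d).val
  simpa using this

/-! ### Locally constant labels and their interpolation -/

open Set Topology Filter Pointwise in
/-- A free action of a finite group has an equivariant, locally constant index function near an
invariant finite set. -/
lemma exists_index_near_finite {H X : Type*} [Group H] [Finite H] [TopologicalSpace X] [T2Space X]
    [MulAction H X] [ContinuousConstSMul H X] (hfree : ∀ (h : H) (x : X), h • x = x → h = 1)
    {K : Set X} (hK : K.Finite) (hinv : ∀ (h : H), ∀ x ∈ K, h • x ∈ K) :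
    ∃ (N : Set X) (i : X → H), IsOpen N ∧ K ⊆ N ∧ (∀ (h : H), ∀ x ∈ N, h • x ∈ N) ∧
      ∀ x ∈ N, (∀ h : H, i (h • x) = h * i x) ∧ ∀ᶠ y in 𝓝 x, i y = i x := by
  classical
  obtain ⟨σ, hσ⟩ := MulAction.exists_map_smul_eq_mul H X
  replace hσ (x : X) (h : H) : σ (h • x) = h * σ x := hσ x (fun h ↦ hfree h x) h
  -- Equivariance of `σ` makes `A` a transversal of the orbits in `K`.
  set A : Set X := {x ∈ K | σ x = 1}
  have hA : A.Finite := hK.subset (sep_subset _ _)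
  have hsep (h : H) : ∃ O P : Set X, IsOpen O ∧ IsOpen P ∧ A ⊆ O ∧ (∀ x ∈ A, h • x ∈ P) ∧
      (h ≠ 1 → Disjoint O P) := by
    by_cases h1 : h = 1
    · exact ⟨univ, univ, isOpen_univ, isOpen_univ, subset_univ _, fun _ _ ↦ mem_univ _,
        fun h ↦ (h h1).elim⟩
    · have hdisj : Disjoint A ((h • ·) '' A) := by
        rw [disjoint_left]
        rintro _ hx ⟨y, hy, rfl⟩
        exact h1 (by simpa [hσ, hy.2] using hx.2)
      obtain ⟨O, P, hO, hP, hAO, hAP, hd⟩ :=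
        SeparatedNhds.of_isCompact_isCompact hA.isCompact (hA.image (h • ·)).isCompact hdisj
      exact ⟨O, P, hO, hP, hAO, fun x hx ↦ hAP (mem_image_of_mem _ hx), fun _ ↦ hd⟩
  choose O P hO hP hAO hAP hdisj using hsep
  -- A neighbourhood of `A` disjoint from its nontrivial translates; the label of a point is the
  -- unique `h` whose translate of `U` contains it.
  set U : Set X := ⋂ h : H, O h ∩ (h • ·) ⁻¹' P h with hU
  have hUo : IsOpen U := isOpen_iInter_of_finite fun h ↦
    (hO h).inter ((hP h).preimage (continuous_const_smul h))
  have hAU : A ⊆ U := fun x hx ↦ mem_iInter.2 fun h ↦ ⟨hAO h hx, hAP h x hx⟩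
  have hunique {h : H} {x : X} (hx : x ∈ U) (hhx : h • x ∈ U) : h = 1 := by
    by_contra h1
    exact (hdisj h h1).le_bot ⟨(mem_iInter.1 hhx h).1, (mem_iInter.1 hx h).2⟩
  set N : Set X := {x | ∃ h : H, h⁻¹ • x ∈ U} with hN
  have hNo : IsOpen N := by
    have : N = ⋃ h : H, (h⁻¹ • ·) ⁻¹' U := by ext; simp [hN]
    rw [this]
    exact isOpen_iUnion fun h ↦ hUo.preimage (continuous_const_smul _)
  let i (x : X) : H := if hx : ∃ h : H, h⁻¹ • x ∈ U then hx.choose else 1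
  have hi {x : X} {h : H} (hx : h⁻¹ • x ∈ U) : i x = h := by
    have hex : ∃ h : H, h⁻¹ • x ∈ U := ⟨h, hx⟩
    have h1 : i x = hex.choose := dif_pos hex
    have h2 : (hex.choose⁻¹ * h) • (h⁻¹ • x) ∈ U := by
      rw [mul_smul, smul_inv_smul]; exact hex.choose_spec
    rw [h1, ← inv_mul_eq_one]
    exact hunique hx h2
  refine ⟨N, i, hNo, fun x hx ↦ ⟨σ x, hAU ⟨hinv _ x hx, by simp [hσ]⟩⟩, ?_, ?_⟩
  · rintro h x ⟨k, hk⟩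
    exact ⟨h * k, by simpa [mul_smul] using hk⟩
  · rintro x ⟨k, hk⟩
    refine ⟨fun h ↦ ?_, ?_⟩
    · rw [hi hk, hi (h := h * k)]
      simpa [mul_smul] using hk
    · filter_upwards [(hUo.preimage (continuous_const_smul k⁻¹)).mem_nhds hk] with y hy
      rw [hi hk, hi hy]

open Set Topology Filter Pointwise in
/-- A free action of a finite group on a space which is a one-dimensional manifold away from a
closed invariant set has an equivariant, locally constant index function off that set. -/
lemma exists_index_off_vertices {H X : Type*} [Group H] [Finite H] [TopologicalSpace X]
    [MulAction H X] [ContinuousConstSMul H X] (hfree : ∀ (h : H) (x : X), h • x = x → h = 1)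
    {V K : Set X} (hVK : V ⊆ K) (hK : IsClosed K)
    (hinv : ∀ (h : H), ∀ x ∈ K, h • x ∈ K)
    (hchart : ∀ x ∉ V, ∃ e : OpenPartialHomeomorph X (Fin 1 → ℝ),
        x ∈ e.source ∧ Disjoint e.source V ∧ IsClosed (e.source ∪ V)) :
    ∃ j : X → H, ∀ x ∉ K, (∀ h : H, j (h • x) = h * j x) ∧ ∀ᶠ y in 𝓝 x, j y = j x := by
  obtain ⟨σ, hσ⟩ := MulAction.exists_map_smul_eq_mul H (Set X)
  have hKc (h : H) : h • Kᶜ = Kᶜ := by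
    ext x
    rw [mem_smul_set_iff_inv_smul_mem, mem_compl_iff, mem_compl_iff, not_iff_not]
    exact ⟨fun hx ↦ by simpa using hinv h _ hx, hinv _ x⟩
  have hcomp (h : H) {x : X} (hx : x ∉ K) :
      connectedComponentIn Kᶜ (h • x) = h • connectedComponentIn Kᶜ x := by
    have := (Homeomorph.smul h).image_connectedComponentIn (s := Kᶜ) (x := x) hx
    simp only [Homeomorph.smul_apply] at this
    rw [show (fun x ↦ h • x) '' Kᶜ = h • Kᶜ from rfl, hKc] at this
    exact this.symm
  have hstab {x : X} (hx : x ∉ K) (h : H)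
      (hh : h • connectedComponentIn Kᶜ x = connectedComponentIn Kᶜ x) : h = 1 := by
    obtain ⟨e, hxe, hdisj, hclosed⟩ := hchart x fun h ↦ hx (hVK h)
    set S := connectedComponentIn Kᶜ x
    have hSK : S ⊆ Kᶜ := connectedComponentIn_subset _ _
    have hS : IsPreconnected S := isPreconnected_connectedComponentIn
    have hxS : x ∈ S := mem_connectedComponentIn hx
    have hSe : S ⊆ e.source := by
      -- Off `V` the chart domain is both open and closed, so a component meeting it lies inside it.
      refine hS.subset_left_of_subset_union (v := (e.source ∪ V)ᶜ) e.open_source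
        hclosed.isOpen_compl ?_ ?_ ⟨x, hxS, hxe⟩
      · exact disjoint_compl_right.mono_left subset_union_left
      · intro y hy
        have : y ∉ V := fun h ↦ hSK hy (hVK h)
        by_cases hye : y ∈ e.source <;> simp [hye, this]
    -- The real-valued chart is injective, so equal values at `y` and `h • y` give a fixed point.
    obtain ⟨y, hy, hfix⟩ := hS.exists_eq_smul ⟨x, hxS⟩ (g := h)
      (fun y hy ↦ hh ▸ smul_mem_smul_set hy) (f := fun y ↦ e y 0)
      ((continuous_apply 0).comp_continuousOn (e.continuousOn.mono hSe))
    refine hfree h y (e.injOn (hSe ?_) (hSe hy) ?_)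
    · rw [← hh]; exact smul_mem_smul_set hy
    · ext k; rwa [Subsingleton.elim k 0]
  refine ⟨fun x ↦ σ (connectedComponentIn Kᶜ x), fun x hx ↦ ⟨fun h ↦ ?_, ?_⟩⟩
  · simp only [hcomp h hx, hσ _ (hstab hx)]
  · obtain ⟨e, hxe, -, -⟩ := hchart x fun h ↦ hx (hVK h)
    have hnhds : e '' (e.source ∩ Kᶜ) ∈ 𝓝 (e x) :=
      (e.isOpen_image_of_subset_source (e.open_source.inter hK.isOpen_compl)
        inter_subset_left).mem_nhds ⟨x, ⟨hxe, hx⟩, rfl⟩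
    obtain ⟨r, hr, hball⟩ := Metric.mem_nhds_iff.1 hnhds
    have htarget : Metric.ball (e x) r ⊆ e.target := by
      intro z hz
      obtain ⟨y, hy, rfl⟩ := hball hz
      exact e.map_source hy.1
    have hsub : e.symm '' Metric.ball (e x) r ⊆ Kᶜ := by
      rintro _ ⟨z, hz, rfl⟩
      obtain ⟨y, hy, rfl⟩ := hball hz
      rw [e.left_inv hy.1]
      exact hy.2
    have hconn : IsPreconnected (e.symm '' Metric.ball (e x) r) :=
      (convex_ball (e x) r).isPreconnected.image _ (e.continuousOn_symm.mono htarget)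
    have hx' : x ∈ e.symm '' Metric.ball (e x) r :=
      ⟨e x, Metric.mem_ball_self hr, e.left_inv hxe⟩
    filter_upwards [(e.symm.isOpen_image_of_subset_source Metric.isOpen_ball htarget).mem_nhds hx']
      with y hy
    rw [connectedComponentIn_eq (hconn.subset_connectedComponentIn hx' hsub hy)]

open Set Topology Filter in
/-- An invariant Urysohn function for a finite group action. -/
lemma exists_invariant_urysohn {H X : Type*} [Group H] [Finite H] [TopologicalSpace X]
    [NormalSpace X] [MulAction H X] [ContinuousConstSMul H X] {K N : Set X} (hK : IsClosed K)
    (hN : IsOpen N) (hKN : K ⊆ N) (hKinv : ∀ (h : H), ∀ x ∈ K, h • x ∈ K)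
    (hNinv : ∀ (h : H), ∀ x ∈ N, h • x ∈ N) :
    ∃ φ : C(X, unitInterval), (∀ x ∈ K, φ x = 0) ∧ (∀ x ∉ N, φ x = 1) ∧
      ∀ (h : H) (x : X), φ (h • x) = φ x := by
  have := Fintype.ofFinite H
  obtain ⟨ψ, hψ0, hψ1, hψ⟩ := exists_continuous_zero_one_of_isClosed hK hN.isClosed_compl
    (disjoint_compl_right.mono_left hKN)
  have hcard : (0 : ℝ) < Fintype.card H := by exact_mod_cast Fintype.card_pos
  -- Invariance comes from averaging an ordinary Urysohn function over the group.
  have hmem (x : X) : (∑ h : H, ψ (h • x)) / Fintype.card H ∈ unitInterval := by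
    refine ⟨div_nonneg (Finset.sum_nonneg fun h _ ↦ (hψ _).1) hcard.le, ?_⟩
    rw [div_le_one hcard]
    simpa using Finset.sum_le_sum (s := Finset.univ) fun (h : H) _ ↦ (hψ (h • x)).2
  refine ⟨⟨fun x ↦ ⟨_, hmem x⟩, ?_⟩, fun x hx ↦ ?_, fun x hx ↦ ?_, fun h x ↦ ?_⟩
  · fun_prop
  · refine Subtype.ext ?_
    simp [fun h : H ↦ hψ0 (hKinv h x hx)]
  · have hx' (h : H) : h • x ∈ Nᶜ := fun hh ↦ hx (by simpa using hNinv h⁻¹ _ hh)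
    refine Subtype.ext ?_
    simp [fun h : H ↦ hψ1 (hx' h), hcard.ne']
  · refine Subtype.ext ?_
    have := Equiv.sum_comp (Equiv.mulRight h) fun k : H ↦ ψ (k • x)
    simpa [mul_smul] using congrArg (· / (Fintype.card H : ℝ)) this

open Set Topology Filter Pointwise in
/-- If configurations of `|H|` points in `Y` can be permuted continuously by the right translations
of `H`, then a compact space with a free `H`-action that is a one-dimensional manifold off a finite
set has a map to `Y` which is injective on orbits. -/
lemma exists_continuousMap_injective_on_orbits {H X Y : Type*} [Group H] [Finite H]
    [TopologicalSpace X] [CompactSpace X] [T2Space X] [TopologicalSpace Y]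
    [MulAction H X] [ContinuousConstSMul H X] (hfree : ∀ (h : H) (x : X), h • x = x → h = 1)
    {V : Set X} (hV : V.Finite)
    (hchart : ∀ x ∉ V, ∃ e : OpenPartialHomeomorph X (Fin 1 → ℝ),
        x ∈ e.source ∧ Disjoint e.source V ∧ IsClosed (e.source ∪ V))
    {a : H → Y} (ha : ∀ d : H, JoinedIn {c : H → Y | Function.Injective c} a fun k ↦ a (k * d)) :
    ∃ f : C(X, Y), ∀ x, Function.Injective fun h : H ↦ f (h • x) := by
  set K : Set X := ⋃ h : H, h • V with hKdef
  have hKfin : K.Finite := finite_iUnion fun h ↦ hV.smul_set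
  have hVK : V ⊆ K := by simpa using subset_iUnion (fun h : H ↦ h • V) 1
  have hKinv (h : H) (x : X) (hx : x ∈ K) : h • x ∈ K := by
    obtain ⟨k, hk⟩ := mem_iUnion.1 hx
    exact mem_iUnion.2 ⟨h * k, by rw [mul_smul]; exact smul_mem_smul_set hk⟩
  obtain ⟨N, i, hN, hKN, hNinv, hi⟩ := exists_index_near_finite hfree hKfin hKinv
  obtain ⟨j, hj⟩ := exists_index_off_vertices hfree hVK hKfin.isClosed hKinv hchart
  obtain ⟨φ, hφ0, hφ1, hφ⟩ := exists_invariant_urysohn hKfin.isClosed hN hKN hKinv hNinv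
  choose P hP using ha
  -- The track of coordinate `k` runs from `a k` to `a l`. The path used depends only on `k⁻¹ * l`,
  -- so translating both labels by `h` selects another coordinate of the same configuration.
  let δ (k l : H) (t : unitInterval) : Y := P (k⁻¹ * l) t k
  have hδ (k l : H) : Continuous (δ k l) := (continuous_apply k).comp (P _).continuous
  have hδ0 (k l l' : H) : δ k l 0 = δ k l' 0 := by simp [δ]
  have hδ1 (k k' l : H) : δ k l 1 = δ k' l 1 := by simp [δ]
  have hδinj (k l : H) (t : unitInterval) : Function.Injective fun h : H ↦ δ (h * k) (h * l) t := by
    intro h h' heq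
    have hkey (g : H) : δ (g * k) (g * l) t = P (k⁻¹ * l) t (g * k) := by
      simp only [δ]
      rw [show (g * k)⁻¹ * (g * l) = k⁻¹ * l by group]
    exact mul_right_cancel (hP _ t ((hkey h).symm.trans (heq.trans (hkey h'))))
  -- A label may jump arbitrarily near `x` without harm if all its finitely many branches agree at
  -- `x`. This applies to `j` where `φ = 0` and to `i` where `φ = 1`.
  have hlim (x : X) (δ' : H → unitInterval → Y) (hδ' : ∀ m, Continuous (δ' m)) (k : H)
      (heq : ∀ m, δ' m (φ x) = δ' k (φ x)) (m : X → H) :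
      Tendsto (fun y ↦ δ' (m y) (φ y)) (𝓝 x) (𝓝 (δ' k (φ x))) := by
    intro W hW
    have : ∀ᶠ y in 𝓝 x, ∀ m, δ' m (φ y) ∈ W := eventually_all.2 fun m ↦
      ((hδ' m).comp φ.continuous).continuousAt.eventually_mem (by simpa [heq] using hW)
    exact this.mono fun y hy ↦ hy _
  refine ⟨⟨fun x ↦ δ (i x) (j x) (φ x), ?_⟩, fun x ↦ ?_⟩
  · refine continuous_iff_continuousAt.2 fun x ↦ ?_
    by_cases hxK : x ∈ K
    · refine (hlim x (δ (i x)) (hδ _) (j x) ?_ j).congr' ?_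
      · intro m; rw [hφ0 x hxK]; exact hδ0 _ _ _
      · filter_upwards [(hi x (hKN hxK)).2] with y hy
        rw [hy]
    · by_cases hxN : x ∈ N
      · refine (hlim x (fun _ : H ↦ δ (i x) (j x)) (fun _ ↦ hδ _ _) 1 (fun _ ↦ rfl)
          fun _ ↦ 1).congr' ?_
        filter_upwards [(hi x hxN).2, (hj x hxK).2] with y hy hy'
        rw [hy, hy']
      · refine (hlim x (fun m ↦ δ m (j x)) (fun _ ↦ hδ _ _) (i x) ?_ i).congr' ?_
        · intro m; rw [hφ1 x hxN]; exact hδ1 _ _ _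
        · filter_upwards [(hj x hxK).2] with y hy
          rw [hy]
  · have : (fun h : H ↦ δ (i (h • x)) (j (h • x)) (φ (h • x))) =
        fun h ↦ δ (h * i x) (h * j x) (φ x) := by
      ext h
      rw [hφ]
      by_cases hxK : x ∈ K
      · rw [(hi x (hKN hxK)).1, hφ0 x hxK]
        exact hδ0 _ _ _
      · rw [(hj x hxK).1]
        by_cases hxN : x ∈ N
        · rw [(hi x hxN).1]
        · rw [hφ1 x hxN]
          exact hδ1 _ _ _
    simpa [this] using hδinj (i x) (j x) (φ x)

/-! ### Trees: contractibility, intervals and tripods -/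

namespace SimpleGraph

/-- Every point of the realization of a tree is a vertex or lies on an edge directed away from a
chosen root. -/
lemma IsTree.mem_geomRealization_iff {m : ℕ} {T : SimpleGraph (Fin m)} (hT : T.IsTree)
    (r : Fin m) {p : Fin m → ℝ} :
    p ∈ T.geomRealization ↔ (∃ v, p = Pi.single v 1) ∨ ∃ u v, T.Adj u v ∧
      T.dist r v = T.dist r u + 1 ∧ ∃ t ∈ Set.Icc (0 : ℝ) 1,
        p = (1 - t) • Pi.single u 1 + t • Pi.single v 1 := by
  refine or_congr Iff.rfl ⟨?_, ?_⟩
  · rintro ⟨u, v, huv, hp⟩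
    rcases hT.dist_eq_dist_add_one_of_adj r huv with h | h
    · rw [segment_symm, segment_eq_image] at hp
      obtain ⟨t, ht, rfl⟩ := hp
      exact ⟨v, u, huv.symm, h, t, ht, rfl⟩
    · rw [segment_eq_image] at hp
      obtain ⟨t, ht, rfl⟩ := hp
      exact ⟨u, v, huv, h, t, ht, rfl⟩
  · rintro ⟨u, v, huv, -, t, ht, rfl⟩
    refine ⟨u, v, huv, ?_⟩
    rw [segment_eq_image]
    exact ⟨t, ht, rfl⟩

/-- A vertex of a tree has at most one neighbour closer to the root. -/
lemma IsTree.eq_of_adj_of_dist_lt {V : Type*} {T : SimpleGraph V} (hT : T.IsTree) (r : V)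
    {u u' v : V} (hu : T.Adj u v) (hu' : T.Adj u' v) (hd : T.dist r v = T.dist r u + 1)
    (hd' : T.dist r v = T.dist r u' + 1) : u = u' := by
  have key {w : V} (hw : T.Adj w v) (hdw : T.dist r v = T.dist r w + 1) :
      ∃ p : T.Walk r v, p.IsPath ∧ p.penultimate = w := by
    obtain ⟨q, hq⟩ := hT.connected.exists_walk_length_eq_dist r w
    refine ⟨q.concat hw, Walk.isPath_of_length_eq_dist _ ?_, by simp⟩
    rw [Walk.length_concat, hq, hdw]
  obtain ⟨p, hp, rfl⟩ := key hu hd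
  obtain ⟨q, hq, rfl⟩ := key hu' hd'
  rw [(hT.existsUnique_path r v).unique hp hq]

/-- A vertex of a connected graph other than the root has a neighbour closer to the root. -/
lemma Connected.exists_adj_dist_eq {V : Type*} {T : SimpleGraph V} (hT : T.Connected) (r : V)
    {v : V} (hv : v ≠ r) : ∃ u, T.Adj u v ∧ T.dist r v = T.dist r u + 1 := by
  obtain ⟨q, hq⟩ := hT.exists_walk_length_eq_dist r v
  have hnil : ¬ q.Nil := fun h ↦ hv h.eq.symm
  have hadj : T.Adj q.penultimate v := q.adj_penultimate hnil
  refine ⟨_, hadj, ?_⟩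
  have h1 : T.dist r q.penultimate ≤ q.dropLast.length := dist_le _
  have h2 : q.dropLast.length + 1 = q.length := by
    rw [← Walk.length_concat _ hadj, Walk.concat_dropLast]
  have h3 : T.dist r v ≤ T.dist r q.penultimate + 1 := by
    rw [← dist_eq_one_iff_adj.2 hadj]
    exact hT.dist_triangle
  lia

/-- Every map to the realization of a tree supported on vertices at distance at most `k + 1` from
the root is homotopic to one supported on vertices at distance at most `k`. -/
lemma IsTree.exists_homotopic_of_dist_le {m : ℕ} {T : SimpleGraph (Fin m)} (hT : T.IsTree)
    (r : Fin m) {X : Type*} [TopologicalSpace X] (k : ℕ) (f : C(X, T.geomRealization))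
    (hf : ∀ x v, k + 1 < T.dist r v → (f x).1 v = 0) :
    ∃ g : C(X, T.geomRealization), f.Homotopic g ∧ ∀ x v, k < T.dist r v → (g x).1 v = 0 := by
  classical
  have hpar (v : Fin m) : ∃ u, v ≠ r → T.Adj u v ∧ T.dist r v = T.dist r u + 1 := by
    by_cases hv : v = r
    · exact ⟨r, fun h ↦ (h hv).elim⟩
    · obtain ⟨u, hu⟩ := hT.connected.exists_adj_dist_eq r hv
      exact ⟨u, fun _ ↦ hu⟩
  choose par hpar using hpar
  have hr {v : Fin m} (hv : T.dist r v = k + 1) : v ≠ r := by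
    rintro rfl
    simp at hv
  -- At time `s` each vertex of level `k + 1` has moved a fraction `s` of the way to its parent; `A
  -- s` extends this linearly.
  let b (s : ℝ) (v : Fin m) : Fin m → ℝ :=
    if T.dist r v = k + 1 then (1 - s) • Pi.single v 1 + s • Pi.single (par v) 1 else Pi.single v 1
  let A (s : ℝ) (p : Fin m → ℝ) : Fin m → ℝ := ∑ v, p v • b s v
  have hA_single (s : ℝ) (v : Fin m) : A s (Pi.single v 1) = b s v := by
    simp [A]
  have hA_comb (s c d : ℝ) (p q : Fin m → ℝ) : A s (c • p + d • q) = c • A s p + d • A s q := by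
    simp only [A, Pi.add_apply, Pi.smul_apply, add_smul, Finset.sum_add_distrib, smul_assoc,
      Finset.smul_sum]
  have hb {s : ℝ} (hs : s ∈ Set.Icc (0 : ℝ) 1) (v : Fin m) : b s v ∈ T.geomRealization := by
    by_cases hv : T.dist r v = k + 1
    · refine .inr ⟨v, par v, (hpar v (hr hv)).1.symm, ?_⟩
      rw [segment_eq_image]
      exact ⟨s, hs, by simp [b, hv]⟩
    · exact .inl ⟨v, by simp [b, hv]⟩
  have hA_mem {s : ℝ} (hs : s ∈ Set.Icc (0 : ℝ) 1) {p : Fin m → ℝ} (hp : p ∈ T.geomRealization)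
      (hp0 : ∀ v, k + 1 < T.dist r v → p v = 0) : A s p ∈ T.geomRealization := by
    rcases (hT.mem_geomRealization_iff r).1 hp with ⟨v, rfl⟩ | ⟨u, v, huv, hd, t, ht, rfl⟩
    · rw [hA_single]
      exact hb hs v
    · rw [hA_comb, hA_single, hA_single]
      -- Edges below level `k + 1` stay fixed and edges ending there shrink. On an edge ending
      -- higher, the support condition leaves only its lower endpoint `u`.
      rcases lt_trichotomy (T.dist r v) (k + 1) with h | h | h
      · simp only [b, h.ne, show T.dist r u ≠ k + 1 by lia, if_false]
        exact hp
      · have hu : u = par v := by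
          obtain ⟨h1, h2⟩ := hpar v (hr h)
          exact hT.eq_of_adj_of_dist_lt r huv h1 hd h2
        refine (hT.mem_geomRealization_iff r).2 (.inr ⟨u, v, huv, hd, t * (1 - s), ?_, ?_⟩)
        · exact ⟨mul_nonneg ht.1 (by linarith [hs.2]),
            mul_le_one₀ ht.2 (by linarith [hs.2]) (by linarith [hs.1])⟩
        · simp only [b, h, show T.dist r u ≠ k + 1 by lia, if_false, if_true, ← hu]
          module
      · have ht0 : t = 0 := by
          simpa [huv.ne', huv.ne] using hp0 v h
        subst ht0
        simpa using hb hs u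
  have hcont : Continuous fun q : ℝ × (Fin m → ℝ) ↦ A q.1 q.2 := by
    refine continuous_finsetSum _ fun v _ ↦ ?_
    by_cases hv : T.dist r v = k + 1
    · simp only [b, hv, if_true]; fun_prop
    · simp only [b, hv, if_false]; fun_prop
  have hmem (s : unitInterval) (x : X) : A s (f x).1 ∈ T.geomRealization :=
    hA_mem s.2 (f x).2 (hf x)
  have hzero (p : Fin m → ℝ) : A 0 p = p := by
    ext w
    simp [A, b, Finset.sum_apply, Pi.single_apply]
  let F : C(unitInterval × X, T.geomRealization) :=
    ⟨fun q ↦ ⟨A q.1 (f q.2).1, hmem q.1 q.2⟩, by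
      refine Continuous.subtype_mk ?_ _
      exact hcont.comp (by fun_prop : Continuous fun q : unitInterval × X ↦
        ((q.1 : ℝ), (f q.2 : Fin m → ℝ)))⟩
  refine ⟨⟨fun x ↦ F (1, x), by fun_prop⟩, ⟨⟨F, fun x ↦ ?_, fun x ↦ rfl⟩⟩, fun x v hv ↦ ?_⟩
  · exact Subtype.ext (hzero _)
  · change A 1 (f x).1 v = 0
    simp only [A, Finset.sum_apply, Pi.smul_apply, smul_eq_mul]
    refine Finset.sum_eq_zero fun w _ ↦ ?_
    rcases lt_trichotomy (T.dist r w) (k + 1) with h | h | h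
    · have : v ≠ w := by rintro rfl; lia
      simp [b, h.ne, this]
    · have : v ≠ par w := by
        have := (hpar w (hr h)).2
        rintro rfl; lia
      simp [b, h, this]
    · rw [hf x w h, zero_mul]

/-- Every map to the realization of a tree is homotopic to a constant map. -/
lemma IsTree.homotopic_const {m : ℕ} {T : SimpleGraph (Fin m)} (hT : T.IsTree)
    (r : Fin m) {X : Type*} [TopologicalSpace X] (f : C(X, T.geomRealization)) :
    f.Homotopic (ContinuousMap.const X ⟨Pi.single r 1, .inl ⟨r, rfl⟩⟩) := by
  have key (k : ℕ) : ∀ f : C(X, T.geomRealization),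
      (∀ x v, k < T.dist r v → (f x).1 v = 0) →
      f.Homotopic (ContinuousMap.const X ⟨Pi.single r 1, .inl ⟨r, rfl⟩⟩) := by
    induction k with
    | zero =>
      intro f hf
      convert ContinuousMap.Homotopic.refl f
      ext x : 1
      have hpos {v : Fin m} (hv : v ≠ r) : (f x).1 v = 0 :=
        hf x v (hT.connected.pos_dist_of_ne hv.symm)
      refine Subtype.ext ?_
      change Pi.single r 1 = (f x).1
      have hmem := (hT.mem_geomRealization_iff r).1 (f x).2
      generalize (f x).1 = p at hmem hpos
      rcases hmem with ⟨v, rfl⟩ | ⟨u, v, huv, hd, t, -, rfl⟩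
      · by_cases hv : v = r
        · rw [hv]
        · simpa using hpos hv
      · have hv : v ≠ r := by rintro rfl; simp at hd
        have ht : t = 0 := by simpa [huv.ne', huv.ne] using hpos hv
        subst ht
        by_cases hu : u = r
        · simp [hu]
        · simpa using hpos hu
    | succ k ih =>
      intro f hf
      obtain ⟨g, hfg, hg⟩ := hT.exists_homotopic_of_dist_le r k f hf
      exact hfg.trans (ih g hg)
  refine key (Finset.univ.sup (T.dist r)) f fun x v hv ↦ ?_
  exact absurd (Finset.le_sup (f := T.dist r) (Finset.mem_univ v)) hv.not_ge

/-- In a tree without branching, vertices are determined by their distance to a leaf. -/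
lemma IsTree.dist_injective_of_degree_le_two {V : Type*} [Fintype V] [DecidableEq V]
    {T : SimpleGraph V}
    [DecidableRel T.Adj] (hT : T.IsTree) (hdeg : ∀ v, T.degree v ≤ 2) {r : V}
    (hr : T.degree r = 1) : Function.Injective (T.dist r) := by
  have key (k : ℕ) : ∀ u v, T.dist r u = k → T.dist r v = k → u = v := by
    induction k with
    | zero =>
      intro u v hu hv
      rw [hT.connected.dist_eq_zero_iff] at hu hv
      rw [← hu, ← hv]
    | succ k ih =>
      intro u v hu hv
      have hur : u ≠ r := by rintro rfl; simp at hu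
      have hvr : v ≠ r := by rintro rfl; simp at hv
      obtain ⟨u', hu', hdu⟩ := hT.connected.exists_adj_dist_eq r hur
      obtain ⟨v', hv', hdv⟩ := hT.connected.exists_adj_dist_eq r hvr
      obtain rfl := ih u' v' (by lia) (by lia)
      by_contra huv
      -- Two children of `u'` contradict `r` being a leaf if `u' = r`; otherwise they and the parent
      -- of `u'` are three neighbours.
      by_cases hu'r : u' = r
      · subst hu'r
        rw [← card_neighborFinset_eq_degree, Finset.card_eq_one] at hr
        obtain ⟨w, hw⟩ := hr
        have h1 : u ∈ T.neighborFinset u' := by simpa using hu'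
        have h2 : v ∈ T.neighborFinset u' := by simpa using hv'
        rw [hw, Finset.mem_singleton] at h1 h2
        exact huv (h1.trans h2.symm)
      · obtain ⟨w, hw, hdw⟩ := hT.connected.exists_adj_dist_eq r hu'r
        have h3 : ({u, v, w} : Finset V) ⊆ T.neighborFinset u' := by
          intro z
          simp only [Finset.mem_insert, Finset.mem_singleton, mem_neighborFinset]
          rintro (rfl | rfl | rfl)
          exacts [hu', hv', hw.symm]
        have h4 := Finset.card_le_card h3
        have huw : u ≠ w := by rintro rfl; lia
        have hvw : v ≠ w := by rintro rfl; lia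
        rw [Finset.card_eq_three.2 ⟨u, v, w, huv, huw, hvw, rfl⟩,
          card_neighborFinset_eq_degree] at h4
        have := hdeg u'
        lia
  exact fun u v huv ↦ key _ u v rfl huv.symm

lemma isCompact_geomRealization {m : ℕ} (T : SimpleGraph (Fin m)) :
    IsCompact T.geomRealization := by
  have h : T.geomRealization = (⋃ v, {Pi.single v 1}) ∪ ⋃ e : {e : Fin m × Fin m // T.Adj e.1 e.2},
      segment ℝ (Pi.single e.1.1 (1 : ℝ)) (Pi.single e.1.2 (1 : ℝ)) := by
    ext p
    simp [geomRealization, eq_comm (a := p)]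
  rw [h]
  refine (isCompact_iUnion fun v ↦ isCompact_singleton).union (isCompact_iUnion fun e ↦ ?_)
  rw [segment_eq_image]
  exact isCompact_Icc.image (by fun_prop)

/-- The realization of a nontrivial tree without branching is an interval. -/
lemma IsTree.nonempty_homeomorph_unitInterval {m : ℕ} {T : SimpleGraph (Fin m)}
    [DecidableRel T.Adj] (hT : T.IsTree) (hdeg : ∀ v, T.degree v ≤ 2)
    [Nontrivial T.geomRealization] : Nonempty (T.geomRealization ≃ₜ unitInterval) := by
  have hnontriv : Nontrivial (Fin m) := by
    by_contra h
    rw [not_nontrivial_iff_subsingleton] at h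
    obtain ⟨⟨p, hp⟩, ⟨q, hq⟩, hpq⟩ := exists_pair_ne T.geomRealization
    refine hpq (Subtype.ext ?_)
    rcases hp with ⟨v, rfl⟩ | ⟨u, v, huv, -⟩
    · rcases hq with ⟨w, rfl⟩ | ⟨u, w, huw, -⟩
      · rw [Subsingleton.elim v w]
      · exact (huw.ne (Subsingleton.elim _ _)).elim
    · exact (huv.ne (Subsingleton.elim _ _)).elim
  obtain ⟨r, hr⟩ := hT.exists_vert_degree_one_of_nontrivial
  have hinj := hT.dist_injective_of_degree_le_two hdeg hr
  let F (p : T.geomRealization) : ℝ := ∑ v, p.1 v * T.dist r v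
  have hF : Continuous F := continuous_finsetSum _ fun v _ ↦
    ((continuous_apply v).comp continuous_subtype_val).mul continuous_const
  -- Vertices sit at distinct integers under `F`, so each barycentric coordinate is a tent function
  -- of `F p`; hence `F` is injective.
  have hrec (p : T.geomRealization) (w : Fin m) : p.1 w = max 0 (1 - |F p - T.dist r w|) := by
    obtain ⟨p, hp⟩ := p
    rcases (hT.mem_geomRealization_iff r).1 hp with ⟨v, rfl⟩ | ⟨u, v, huv, hd, t, ht, rfl⟩
    · have hFv : F ⟨Pi.single v 1, hp⟩ = T.dist r v := by simp [F, Pi.single_apply]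
      rw [hFv]
      by_cases hw : w = v
      · simp [hw]
      · have h1 : (T.dist r v : ℤ) - T.dist r w ≠ 0 := fun h ↦ hw (hinj (by lia))
        have h2 : (1 : ℝ) ≤ |(T.dist r v : ℝ) - T.dist r w| := by
          exact_mod_cast Int.one_le_abs h1
        simp [hw, h2]
    · have hFp : F ⟨_, hp⟩ = T.dist r u + t := by
        simp [F, Pi.single_apply, add_mul, Finset.sum_add_distrib, hd]
        ring
      rw [hFp]
      by_cases hwu : w = u
      · subst hwu
        simp [huv.ne, abs_of_nonneg ht.1, ht.2]
      by_cases hwv : w = v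
      · subst hwv
        simp [hwu, hd, ht.1, abs_of_nonpos (sub_nonpos.2 ht.2)]
      · have h1 : T.dist r w ≠ T.dist r u := fun h ↦ hwu (hinj h)
        have h2 : T.dist r w ≠ T.dist r v := fun h ↦ hwv (hinj h)
        have h3 : (1 : ℝ) ≤ |(T.dist r u : ℝ) + t - T.dist r w| := by
          rcases lt_or_gt_of_ne h1 with h | h
          · have : (T.dist r w : ℝ) + 1 ≤ T.dist r u := by exact_mod_cast h
            exact le_abs.2 (.inl (by linarith [ht.1]))
          · have : (T.dist r u : ℝ) + 2 ≤ T.dist r w := by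
              exact_mod_cast (by lia : T.dist r u + 2 ≤ T.dist r w)
            exact le_abs.2 (.inr (by linarith [ht.2]))
        simp [hwu, hwv, h3]
  have hFinj : Function.Injective F := fun p q hpq ↦
    Subtype.ext (funext fun w ↦ by rw [hrec p, hrec q, hpq])
  have hcompact : CompactSpace T.geomRealization :=
    isCompact_iff_compactSpace.1 T.isCompact_geomRealization
  have hconn : ConnectedSpace T.geomRealization := by
    -- A homotopy of maps from a one-point space is a path.
    have hpath (p : T.geomRealization) : Joined p ⟨Pi.single r 1, .inl ⟨r, rfl⟩⟩ := by
      obtain ⟨h⟩ := hT.homotopic_const r (ContinuousMap.const Unit p)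
      exact ⟨h.evalAt ()⟩
    have : PathConnectedSpace T.geomRealization :=
      ⟨inferInstance, fun p q ↦ (hpath p).trans (hpath q).symm⟩
    infer_instance
  obtain ⟨p, hp⟩ := (isCompact_range hF).exists_isLeast (Set.range_nonempty F)
  obtain ⟨q, hq⟩ := (isCompact_range hF).exists_isGreatest (Set.range_nonempty F)
  have hrange : Set.range F = Set.Icc p q := Set.Subset.antisymm
    (fun x hx ↦ ⟨hp.2 hx, hq.2 hx⟩) ((isPreconnected_range hF).Icc_subset hp.1 hq.1)
  have hpq : p < q := by
    obtain ⟨x, y, hxy⟩ := exists_pair_ne T.geomRealization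
    by_contra! hle
    have hx := Set.mem_range_self (f := F) x
    have hy := Set.mem_range_self (f := F) y
    rw [hrange] at hx hy
    exact hxy (hFinj (by linarith [hx.1, hx.2, hy.1, hy.2]))
  exact ⟨(((hF.isClosedEmbedding hFinj).isEmbedding.toHomeomorph).trans
    (Homeomorph.setCongr hrange)).trans (iccHomeoI p q hpq)⟩

/-- The realization of a tree with a branching vertex contains a tripod, so that configurations of
points in it can be shifted cyclically. -/
lemma exists_joinedIn_shift_of_two_lt_degree {m : ℕ} {T : SimpleGraph (Fin m)}
    [DecidableRel T.Adj] {v : Fin m} (hv : 2 < T.degree v) (n : ℕ) [NeZero n] :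
    ∃ a : ZMod n → T.geomRealization, ∀ d : ZMod n,
      JoinedIn {c : ZMod n → T.geomRealization | Function.Injective c} a (fun k ↦ a (k + d)) := by
  rw [← card_neighborFinset_eq_degree, Finset.two_lt_card] at hv
  obtain ⟨u, hu, w, hw, z, hz, huw, huz, hwz⟩ := hv
  rw [mem_neighborFinset] at hu hw hz
  have hR : (0 : ℝ) < n + 1 := by positivity
  have hmem {x : Fin m} (hx : T.Adj v x) (t : ℝ) (ht : t ∈ Set.Icc (0 : ℝ) 1) :
      (1 - t) • Pi.single v (1 : ℝ) + t • Pi.single x 1 ∈ T.geomRealization := by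
    refine .inr ⟨v, x, hx, ?_⟩
    rw [segment_eq_image]
    exact ⟨t, ht, rfl⟩
  -- Rescaling `[-(n + 1), n + 1]` to `[-1, 1]` and clamping outside makes the line total. Positive
  -- values go on the edge to `u`, negative ones on the edge to `w`; `z` ends the parking leg.
  let c (s : ℝ) : ℝ := max (-1) (min 1 (s / (n + 1)))
  have hc (s : ℝ) : c s ∈ Set.Icc (-1 : ℝ) 1 :=
    ⟨le_max_left _ _, max_le (by norm_num) (min_le_left _ _)⟩
  have hcs {s : ℝ} (hs : s ∈ Set.Icc (-(n + 1) : ℝ) (n + 1)) : c s = s / (n + 1) := by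
    have h1 : s / (n + 1) ≤ 1 := (div_le_one hR).2 hs.2
    have h2 : -1 ≤ s / (n + 1) := by rw [le_div_iff₀ hR]; linarith [hs.1]
    simp [c, h1, h2]
  let l (x : ℝ) : Fin m → ℝ :=
    (1 - |x|) • Pi.single v 1 + max x 0 • Pi.single u 1 + max (-x) 0 • Pi.single w 1
  have hl {x : ℝ} (hx : x ∈ Set.Icc (-1 : ℝ) 1) : l x ∈ T.geomRealization := by
    rcases le_total 0 x with h | h
    · simpa [l, abs_of_nonneg h, max_eq_left h, max_eq_right (neg_nonpos.2 h)] using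
        hmem hu x ⟨h, hx.2⟩
    · simpa [l, abs_of_nonpos h, max_eq_right h, max_eq_left (neg_nonneg.2 h)] using
        hmem hw (-x) ⟨by linarith, by linarith [hx.1]⟩
  let L (s : ℝ) : T.geomRealization := ⟨l (c s), hl (hc s)⟩
  let S (s : ℝ) : T.geomRealization :=
    ⟨_, hmem hz (max 0 (min 1 s)) ⟨le_max_left _ _, max_le (by norm_num) (min_le_left _ _)⟩⟩
  have hLu (s : ℝ) : (L s).1 u = max (c s) 0 := by simp [L, l, hu.ne', huw]
  have hLw (s : ℝ) : (L s).1 w = max (-c s) 0 := by simp [L, l, hw.ne', huw.symm]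
  have hLz (s : ℝ) : (L s).1 z = 0 := by simp [L, l, hz.ne', huz.symm, hwz.symm]
  refine exists_joinedIn_injective_shift (L := L) (S := S) ?_ ?_ ?_ ?_ ?_
  · exact Continuous.subtype_mk (by fun_prop) _
  · exact Continuous.subtype_mk (by fun_prop) _
  · refine Subtype.ext ?_
    simp [S, L, l, c]
  · intro s hs s' hs' heq
    have h1 : max (c s) 0 = max (c s') 0 := by rw [← hLu, ← hLu, heq]
    have h2 : max (-c s) 0 = max (-c s') 0 := by rw [← hLw, ← hLw, heq]
    have h3 : c s = c s' := by
      rw [← max_zero_sub_max_neg_zero_eq_self (c s), ← max_zero_sub_max_neg_zero_eq_self (c s'),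
        h1, h2]
    rw [hcs hs, hcs hs'] at h3
    field_simp at h3
    exact h3
  · intro s _ t ht heq
    have h := congrArg (fun p : T.geomRealization ↦ p.1 z) heq
    simp only [hLz] at h
    have : t = 0 := by simpa [S, hz.ne', hz.ne, min_eq_right ht.2, max_eq_right ht.1.le] using h
    exact ht.1.ne' this

end SimpleGraph

/-! ### The Borsuk–Ulam statements -/

/-- Every map from a connected space with an action of a nontrivial finite group to the unit
interval identifies two points of some orbit. -/
lemma tripleHasBorsukUlam_unitInterval (H X : Type*) [Group H] [Finite H] [Nontrivial H]
    [TopologicalSpace X] [ConnectedSpace X] [MulAction H X] [ContinuousConstSMul H X] :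
    TripleHasBorsukUlam H X unitInterval := by
  intro α f _
  obtain ⟨g, hg⟩ := exists_ne (1 : H)
  obtain ⟨x, -, hx⟩ := (isPreconnected_univ (α := X)).exists_eq_smul Set.univ_nonempty
    (g := g) (fun _ _ ↦ Set.mem_univ _) (f := fun x ↦ (f x : ℝ)) (by fun_prop)
  exact ⟨g, 1, x, hg, Subtype.ext (by simpa using hx)⟩

lemma TripleHasBorsukUlam.of_homeomorph {H X Y Z : Type*} [Group H] [TopologicalSpace X]
    [TopologicalSpace Y] [TopologicalSpace Z] [MulAction H X] (h : TripleHasBorsukUlam H X Y)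
    (e : Z ≃ₜ Y) : TripleHasBorsukUlam H X Z := by
  intro α f _
  obtain ⟨h₁, h₂, x, hne, hx⟩ := h _ ((e : C(Z, Y)).comp f) rfl
  exact ⟨h₁, h₂, x, hne, e.injective hx⟩

/-- Any two maps to a topological tree are homotopic. -/
lemma IsTopologicalTree.homotopic {G X : Type*} [TopologicalSpace G] [TopologicalSpace X]
    (hG : IsTopologicalTree G) (f g : C(X, G)) : f.Homotopic g := by
  obtain ⟨m, T, hT, ⟨e⟩⟩ := hG
  obtain ⟨r⟩ := hT.connected.nonempty
  have h : ((e : C(G, T.geomRealization)).comp f).Homotopic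
      ((e : C(G, T.geomRealization)).comp g) :=
    (hT.homotopic_const r _).trans (hT.homotopic_const r _).symm
  have h' := (ContinuousMap.Homotopic.refl (e.symm : C(T.geomRealization, G))).comp h
  convert h' using 1 <;> ext x <;> simp

theorem mainTheorem3 {n : ℕ} (hn : 2 ≤ n)
    (Γ : Type*) [TopologicalSpace Γ] (hΓ : IsFiniteGraph Γ) [ConnectedSpace Γ]
    [MulAction (Multiplicative (ZMod n)) Γ] [ContinuousConstSMul (Multiplicative (ZMod n)) Γ]
    (hfree : ∀ (h : Multiplicative (ZMod n)) (x : Γ), h • x = x → h = 1) :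
    TripleHasBorsukUlam (Multiplicative (ZMod n)) Γ unitInterval ∧
    (∀ (G : Type*) [TopologicalSpace G], Nonempty (G ≃ₜ unitInterval) →
      TripleHasBorsukUlam (Multiplicative (ZMod n)) Γ G) ∧
    (∀ (G : Type*) [TopologicalSpace G], IsTopologicalTree G → Nontrivial G →
      ¬ Nonempty (G ≃ₜ unitInterval) →
      ∃ α : FreeHomotopyClass Γ G, (∀ β : FreeHomotopyClass Γ G, β = α) ∧
        ¬ α.HasBorsukUlam (Multiplicative (ZMod n))) := by
  classical
  have : NeZero n := ⟨by lia⟩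
  have : Fact (1 < n) := ⟨by lia⟩
  have hI := tripleHasBorsukUlam_unitInterval (Multiplicative (ZMod n)) Γ
  refine ⟨hI, fun G _ ⟨e⟩ ↦ hI.of_homeomorph e, fun G _ hG hGnt hGI ↦ ?_⟩
  obtain ⟨m, T, hT, ⟨e⟩⟩ := id hG
  have hbranch : ∃ v, 2 < T.degree v := by
    by_contra! hdeg
    have : Nontrivial T.geomRealization := e.symm.toEquiv.nontrivial
    obtain ⟨e'⟩ := hT.nonempty_homeomorph_unitInterval hdeg
    exact hGI ⟨e.trans e'⟩
  obtain ⟨v, hv⟩ := hbranch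
  obtain ⟨a, ha⟩ := SimpleGraph.exists_joinedIn_shift_of_two_lt_degree hv n
  have := hΓ.1
  obtain ⟨_, V, hV, hchart⟩ := hΓ.exists_finite_charts
  obtain ⟨f, hf⟩ := exists_continuousMap_injective_on_orbits (H := Multiplicative (ZMod n)) hfree hV
    hchart (a := fun k ↦ a k.toAdd) fun d ↦ ha d.toAdd
  refine ⟨freeHomotopyClassOf ((e.symm : C(T.geomRealization, G)).comp f), fun β ↦ ?_, fun h ↦ ?_⟩
  · induction β using Quotient.inductionOn with
    | h g => exact Quotient.sound (hG.homotopic _ _)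
  · obtain ⟨h₁, h₂, x, hne, hx⟩ := h _ rfl
    exact hne (hf x (e.symm.injective hx))
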